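/- Let $I=[0,1]$. A (bivariate) copula is a function $C:I^2\to\mathbb R$ with $C(u,0)=C(0,v)=0$, $C(u,1)=u$, $C(1,v)=v$ for all $u,v\in I$, and $C(u_2,v_2)-C(u_1,v_2)-C(u_2,v_1)+C(u_1,v_1)\ge 0$ whenever $u_1\le u_2$ and $v_1\le v_2$ in $I$. Put $$\mu_\infty(C)=\max_{u,v\in I}|C(u,v)-C(v,u)|,\qquad \tau(C)=4\int_{I^2}C(u,v)\,dC(u,v)-1,$$ where $dC$ denotes the Borel probability measure on $I^2$ that gives each rectangle $[0,u]\times[0,v]$ the mass $C(u,v)$; $\tau(C)$ is Kendall's tau of $C$. Let $C$ be a copula and $\tau=\tau(C)$. Then $-1\le\tau\le 1$ and $$0\le\mu_\infty(C)\le\begin{cases}\sqrt{\dfrac{1+\tau}{4}}, & -1\le\tau\le-\frac59,\\[2mm] \dfrac13, & -\frac59\le\tau\le\frac19,\\[2mm] \sqrt{\dfrac{1-\tau}{8}}, & \frac19\le\tau\le 1,\end{cases}$$ and these bounds are attained: for every $\tau\in[-1,1]$ there are a copula $C$ with $\tau(C)=\tau$ and $\mu_\infty(C)=0$, and a copula $C$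 with $\tau(C)=\tau$ for which $\mu_\infty(C)$ equals the upper bound above. -/

import Mathlib

open MeasureTheory Filter Topology unitInterval

/-- A bivariate copula: a function on the unit square that is grounded, has uniform margins and
is 2-increasing (every rectangle has non-negative volume). -/
structure Copula where
  toFun : I → I → ℝ
  zero_left : ∀ v, toFun 0 v = 0
  zero_right : ∀ u, toFun u 0 = 0
  one_left : ∀ v, toFun 1 v = v
  one_right : ∀ u, toFun u 1 = u
  two_increasing : ∀ u₁ u₂ v₁ v₂, u₁ ≤ u₂ → v₁ ≤ v₂ →
    0 ≤ toFun u₂ v₂ - toFun u₁ v₂ - toFun u₂ v₁ + toFun u₁ v₁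

namespace Copula

instance : CoeFun Copula (fun _ => I → I → ℝ) := ⟨Copula.toFun⟩

/-- The transpose of a copula, `(u, v) ↦ C (v, u)`. -/
def transpose (C : Copula) : Copula where
  toFun u v := C v u
  zero_left := C.zero_right
  zero_right := C.zero_left
  one_left := C.one_right
  one_right := C.one_left
  two_increasing u₁ u₂ v₁ v₂ hu hv := by
    have h := C.two_increasing v₁ v₂ u₁ u₂ hv hu
    linarith

/-- The uniform distance of two copulas: the supremum, over the unit square, of the absolute
value of their difference. -/
noncomputable def supDist (C D : Copula) : ℝ := ⨆ p : I × I, |C p.1 p.2 - D p.1 p.2|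

/-- The measure of asymmetry (non-exchangeability) `μ_∞`: the uniform distance of a copula from
its transpose. -/
noncomputable def asymmetry (C : Copula) : ℝ := supDist C C.transpose

/-! ### The probability measure induced by a copula -/

theorem mono_left (C : Copula) {u u' : I} (h : u ≤ u') (v : I) : C u v ≤ C u' v := by
  have := C.two_increasing u u' 0 v h v.2.1
  rw [C.zero_right, C.zero_right] at this
  linarith

theorem mono_right (C : Copula) (u : I) {v v' : I} (h : v ≤ v') : C u v ≤ C u v' :=
  C.transpose.mono_left h u

theorem sub_le_left (C : Copula) {u u' : I} (h : u ≤ u') (v : I) :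
    C u' v - C u v ≤ (u' : ℝ) - u := by
  have := C.two_increasing u u' v 1 h v.2.2
  rw [C.one_right, C.one_right] at this
  linarith

theorem sub_le_right (C : Copula) (u : I) {v v' : I} (h : v ≤ v') :
    C u v' - C u v ≤ (v' : ℝ) - v :=
  C.transpose.sub_le_left h u

theorem nonneg (C : Copula) (u v : I) : 0 ≤ C u v := by
  rw [← C.zero_left v]; exact C.mono_left u.2.1 v

/-- The point `k / n` of the unit interval (cut off at `1`). -/
noncomputable def gridPt (n k : ℕ) : I := Set.projIcc 0 1 zero_le_one ((k : ℝ) / n)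

theorem gridPt_coe {n k : ℕ} (hn : 0 < n) (hk : k ≤ n) : (gridPt n k : ℝ) = k / n := by
  have : (k : ℝ) / n ≤ 1 := by
    rw [div_le_one (by exact_mod_cast hn)]; exact_mod_cast hk
  simp only [gridPt, Set.coe_projIcc]
  rw [min_eq_right this, max_eq_right (by positivity)]

theorem gridPt_mono (n : ℕ) {k l : ℕ} (h : k ≤ l) : gridPt n k ≤ gridPt n l := by
  apply Set.monotone_projIcc
  gcongr

theorem gridPt_zero (n : ℕ) : gridPt n 0 = 0 := by
  simp [gridPt]

/-- The mass a copula gives to a cell of the grid of mesh `1 / n`. -/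
noncomputable def cell (C : Copula) (n i j : ℕ) : ℝ :=
  C (gridPt n (i + 1)) (gridPt n (j + 1)) - C (gridPt n i) (gridPt n (j + 1))
    - C (gridPt n (i + 1)) (gridPt n j) + C (gridPt n i) (gridPt n j)

theorem cell_nonneg (C : Copula) (n i j : ℕ) : 0 ≤ C.cell n i j :=
  C.two_increasing _ _ _ _ (gridPt_mono n (Nat.le_succ i)) (gridPt_mono n (Nat.le_succ j))

theorem sum_cell (C : Copula) (n k l : ℕ) :
    ∑ i ∈ Finset.range k, ∑ j ∈ Finset.range l, C.cell n i j = C (gridPt n k) (gridPt n l) := by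
  have h1 : ∀ i, ∑ j ∈ Finset.range l, C.cell n i j =
      C (gridPt n (i + 1)) (gridPt n l) - C (gridPt n i) (gridPt n l) := by
    intro i
    have h := Finset.sum_range_sub
      (fun j => C (gridPt n (i + 1)) (gridPt n j) - C (gridPt n i) (gridPt n j)) l
    simp only [gridPt_zero, C.zero_right] at h
    rw [sub_zero, sub_zero] at h
    rw [← h]
    refine Finset.sum_congr rfl fun j _ => ?_
    simp only [cell]; ring
  simp only [h1]
  have h := Finset.sum_range_sub (fun i => C (gridPt n i) (gridPt n l)) k
  simp only [gridPt_zero, C.zero_left, sub_zero] at h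
  exact h

/-- The discrete approximation, on the grid of mesh `1 / n`, of the measure of a copula. -/
noncomputable def gridMeasure (C : Copula) (n : ℕ) : Measure (I × I) :=
  ∑ i ∈ Finset.range n, ∑ j ∈ Finset.range n,
    ENNReal.ofReal (C.cell n i j) • Measure.dirac (gridPt n (i + 1), gridPt n (j + 1))

theorem gridPt_le_iff {n i : ℕ} (hi : i < n) (u : I) :
    gridPt n (i + 1) ≤ u ↔ i < ⌊(n : ℝ) * u⌋₊ := by
  have hn : 0 < n := by omega
  have hn' : (0 : ℝ) < n := by exact_mod_cast hn
  rw [← Subtype.coe_le_coe, gridPt_coe hn (by omega), div_le_iff₀ hn', ← Nat.succ_le_iff,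
    Nat.le_floor_iff (mul_nonneg hn'.le u.2.1), mul_comm]

theorem gridMeasure_apply (C : Copula) (n : ℕ) (u v : I) :
    C.gridMeasure n (Set.Iic u ×ˢ Set.Iic v) =
      ENNReal.ofReal (C (gridPt n ⌊(n : ℝ) * u⌋₊) (gridPt n ⌊(n : ℝ) * v⌋₊)) := by
  have hfl : ∀ w : I, ⌊(n : ℝ) * w⌋₊ ≤ n := fun w => by
    apply Nat.floor_le_of_le
    have := w.2.2
    have h0 : (0 : ℝ) ≤ n := Nat.cast_nonneg n
    nlinarith
  have hm : MeasurableSet (Set.Iic u ×ˢ Set.Iic v) := measurableSet_Iic.prod measurableSet_Iic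
  rw [← sum_cell, ENNReal.ofReal_sum_of_nonneg
    (fun i _ => Finset.sum_nonneg fun j _ => C.cell_nonneg n i j)]
  simp only [gridMeasure, Measure.coe_finsetSum, Finset.sum_apply, Measure.smul_apply,
    smul_eq_mul, Measure.dirac_apply' _ hm]
  rw [← Finset.sum_subset (Finset.range_mono (hfl u))]
  · refine Finset.sum_congr rfl fun i hi => ?_
    have hi' := Finset.mem_range.1 hi
    have hin : i < n := lt_of_lt_of_le hi' (hfl u)
    rw [ENNReal.ofReal_sum_of_nonneg (fun j _ => C.cell_nonneg n i j),
      ← Finset.sum_subset (Finset.range_mono (hfl v))]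
    · refine Finset.sum_congr rfl fun j hj => ?_
      have hj' := Finset.mem_range.1 hj
      have hjn : j < n := lt_of_lt_of_le hj' (hfl v)
      rw [Set.indicator_of_mem]
      · simp
      · exact ⟨(gridPt_le_iff hin u).2 hi', (gridPt_le_iff hjn v).2 hj'⟩
    · intro j hj hj'
      rw [Set.indicator_of_notMem, mul_zero]
      rintro ⟨-, h⟩
      exact hj' (Finset.mem_range.2 ((gridPt_le_iff (Finset.mem_range.1 hj) v).1 h))
  · intro i hi hi'
    refine Finset.sum_eq_zero fun j _ => ?_
    rw [Set.indicator_of_notMem, mul_zero]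
    rintro ⟨h, -⟩
    exact hi' (Finset.mem_range.2 ((gridPt_le_iff (Finset.mem_range.1 hi) u).1 h))

theorem gridPt_floor_le {n : ℕ} (hn : 0 < n) (u : I) : gridPt n ⌊(n : ℝ) * u⌋₊ ≤ u := by
  have hn' : (0 : ℝ) < n := by exact_mod_cast hn
  have h0 := u.2.1
  have h1 := u.2.2
  have hfl : ⌊(n : ℝ) * u⌋₊ ≤ n := Nat.floor_le_of_le (by nlinarith)
  rw [← Subtype.coe_le_coe, gridPt_coe hn hfl, div_le_iff₀ hn', mul_comm]
  exact Nat.floor_le (by positivity)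

theorem le_gridPt_floor {n : ℕ} (hn : 0 < n) (u : I) :
    (u : ℝ) - 1 / n ≤ gridPt n ⌊(n : ℝ) * u⌋₊ := by
  have hn' : (0 : ℝ) < n := by exact_mod_cast hn
  have h0 := u.2.1
  have h1 := u.2.2
  have hfl : ⌊(n : ℝ) * u⌋₊ ≤ n := Nat.floor_le_of_le (by nlinarith)
  have := Nat.lt_floor_add_one ((n : ℝ) * u)
  rw [gridPt_coe hn hfl, sub_le_iff_le_add, ← add_div, le_div_iff₀ hn', mul_comm]
  exact this.le

theorem gridMeasure_apply_le (C : Copula) {n : ℕ} (hn : 0 < n) (u v : I) :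
    C.gridMeasure n (Set.Iic u ×ˢ Set.Iic v) ≤ ENNReal.ofReal (C u v) := by
  rw [gridMeasure_apply]
  exact ENNReal.ofReal_le_ofReal ((C.mono_left (gridPt_floor_le hn u) _).trans
    (C.mono_right _ (gridPt_floor_le hn v)))

theorem le_gridMeasure_apply (C : Copula) {n : ℕ} (hn : 0 < n) (u v : I) :
    ENNReal.ofReal (C u v - 2 / n) ≤ C.gridMeasure n (Set.Iic u ×ˢ Set.Iic v) := by
  rw [gridMeasure_apply]
  apply ENNReal.ofReal_le_ofReal
  have h1 := C.sub_le_left (gridPt_floor_le hn u) v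
  have h2 := C.sub_le_right (gridPt n ⌊(n : ℝ) * u⌋₊) (gridPt_floor_le hn v)
  have h3 := le_gridPt_floor hn u
  have h4 := le_gridPt_floor hn v
  have h5 : (2 : ℝ) / n = 1 / n + 1 / n := by ring
  rw [h5]
  linarith

theorem Iic_one_prod : (Set.Iic (1 : I) ×ˢ Set.Iic (1 : I)) = Set.univ := by
  ext p
  simp only [Set.mem_prod, Set.mem_Iic, Set.mem_univ, iff_true]
  exact ⟨p.1.2.2, p.2.2.2⟩

theorem gridPt_self {n : ℕ} (hn : 0 < n) : gridPt n n = 1 := by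
  apply Subtype.ext
  rw [gridPt_coe hn le_rfl]
  have hn' : (n : ℝ) ≠ 0 := by exact_mod_cast hn.ne'
  simp [hn']

theorem isProbabilityMeasure_gridMeasure (C : Copula) {n : ℕ} (hn : 0 < n) :
    IsProbabilityMeasure (C.gridMeasure n) := by
  constructor
  rw [← Iic_one_prod, gridMeasure_apply]
  simp [gridPt_self hn, C.one_left]

/-- Every copula is the restriction to the unit square of the distribution function of a
Borel probability measure on the unit square. -/
theorem exists_measure (C : Copula) : ∃ μ : Measure (I × I),
    ∀ u v : I, μ (Set.Iic u ×ˢ Set.Iic v) = ENNReal.ofReal (C u v) := by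
  let P : ℕ → ProbabilityMeasure (I × I) := fun n =>
    ⟨C.gridMeasure (n + 1), C.isProbabilityMeasure_gridMeasure n.succ_pos⟩
  obtain ⟨μ, -, hμ⟩ := isCompact_univ.ultrafilter_le_nhds
    ((hyperfilter ℕ : Ultrafilter ℕ).map P) (by simp)
  have hlim : Tendsto P (hyperfilter ℕ : Filter ℕ) (𝓝 μ) := hμ
  have hle : (hyperfilter ℕ : Filter ℕ) ≤ atTop := by
    rw [← Nat.cofinite_eq_atTop]; exact hyperfilter_le_cofinite
  have hz : Tendsto (fun n : ℕ => (2 : ℝ) / ((n + 1 : ℕ) : ℝ)) atTop (𝓝 0) := by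
    have := (tendsto_const_div_atTop_nhds_zero_nat (2 : ℝ)).comp (tendsto_add_atTop_nat 1)
    exact this
  refine ⟨μ, fun u v => le_antisymm ?_ ?_⟩
  · -- outer estimate, by open sets
    have key : ∀ ε : ℝ, 0 < ε →
        (μ : Measure (I × I)) (Set.Iic u ×ˢ Set.Iic v) ≤ ENNReal.ofReal (C u v + 2 * ε) := by
      intro ε hε
      let G : Set (I × I) := {p | (p.1 : ℝ) < u + ε ∧ (p.2 : ℝ) < v + ε}
      have hG : IsOpen G := by
        refine IsOpen.and ?_ ?_
        · exact isOpen_lt (by fun_prop) continuous_const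
        · exact isOpen_lt (by fun_prop) continuous_const
      have hsub : Set.Iic u ×ˢ Set.Iic v ⊆ G := by
        rintro p ⟨h1, h2⟩
        have h1' : (p.1 : ℝ) ≤ u := h1
        have h2' : (p.2 : ℝ) ≤ v := h2
        exact ⟨by linarith, by linarith⟩
      have hup : ∀ w : I, ∃ w' : I, w ≤ w' ∧ (w' : ℝ) - w ≤ ε ∧
          ∀ x : I, (x : ℝ) < w + ε → x ≤ w' := by
        intro w
        refine ⟨⟨min (w + ε) 1, ?_, min_le_right _ _⟩, ?_, ?_, ?_⟩
        · exact le_min (by have := w.2.1; linarith) zero_le_one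
        · exact Subtype.coe_le_coe.1 (le_min (by linarith) w.2.2)
        · have := min_le_left ((w : ℝ) + ε) 1
          simp only; linarith
        · intro x hx
          exact Subtype.coe_le_coe.1 (le_min hx.le x.2.2)
      obtain ⟨u', hu, hu', hu''⟩ := hup u
      obtain ⟨v', hv, hv', hv''⟩ := hup v
      have hb : ∀ n, ((P n : ProbabilityMeasure (I × I)) : Measure (I × I)) G ≤
          ENNReal.ofReal (C u v + 2 * ε) := by
        intro n
        have h1 : G ⊆ Set.Iic u' ×ˢ Set.Iic v' := fun p hp => ⟨hu'' _ hp.1, hv'' _ hp.2⟩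
        refine (measure_mono h1).trans ((C.gridMeasure_apply_le n.succ_pos u' v').trans ?_)
        apply ENNReal.ofReal_le_ofReal
        have h2 := C.sub_le_left hu v'
        have h3 := C.sub_le_right u hv
        linarith
      refine (measure_mono hsub).trans
        ((ProbabilityMeasure.le_liminf_measure_open_of_tendsto hlim hG).trans ?_)
      refine (liminf_le_liminf (Eventually.of_forall hb)).trans ?_
      rw [liminf_const]
    have hc : Tendsto (fun ε : ℝ => ENNReal.ofReal (C u v + 2 * ε)) (𝓝[>] 0)
        (𝓝 (ENNReal.ofReal (C u v))) := by
      have : Continuous fun ε : ℝ => ENNReal.ofReal (C u v + 2 * ε) :=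
        ENNReal.continuous_ofReal.comp (by fun_prop)
      have h := this.tendsto 0
      simp only [mul_zero, add_zero] at h
      exact h.mono_left nhdsWithin_le_nhds
    exact ge_of_tendsto hc (eventually_mem_nhdsWithin.mono fun ε hε => key ε hε)
  · -- inner estimate, by closed sets
    have hcl : IsClosed (Set.Iic u ×ˢ Set.Iic v) := isClosed_Iic.prod isClosed_Iic
    have h1 := ProbabilityMeasure.limsup_measure_closed_le_of_tendsto hlim hcl
    refine le_trans ?_ h1
    have hc : Tendsto (fun n : ℕ => ENNReal.ofReal (C u v - 2 / ((n + 1 : ℕ) : ℝ)))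
        (hyperfilter ℕ : Filter ℕ) (𝓝 (ENNReal.ofReal (C u v))) := by
      have h := (ENNReal.continuous_ofReal.tendsto (C u v - 0)).comp
        ((tendsto_const_nhds (x := C u v)).sub hz)
      rw [sub_zero] at h
      exact h.mono_left hle
    rw [← hc.limsup_eq]
    exact limsup_le_limsup (Eventually.of_forall fun n =>
      C.le_gridMeasure_apply n.succ_pos u v)

/-- The Borel measure on the unit square induced by a copula, that is, the measure `dC`: the one
that gives each rectangle `[0, u] × [0, v]` the mass `C (u, v)`. -/
noncomputable def measure (C : Copula) : Measure (I × I) := C.exists_measure.choose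

theorem measure_Iic_prod (C : Copula) (u v : I) :
    C.measure (Set.Iic u ×ˢ Set.Iic v) = ENNReal.ofReal (C u v) :=
  C.exists_measure.choose_spec u v

instance (C : Copula) : IsProbabilityMeasure C.measure := by
  constructor
  rw [← Iic_one_prod, measure_Iic_prod, C.one_left]
  simp

/-- The values on the rectangles `[0, u] × [0, v]` determine the measure. -/
theorem eq_measure (C : Copula) (μ : Measure (I × I))
    (h : ∀ u v : I, μ (Set.Iic u ×ˢ Set.Iic v) = ENNReal.ofReal (C u v)) : μ = C.measure := by
  have hfin : IsFiniteMeasure μ := ⟨by rw [← Iic_one_prod, h]; exact ENNReal.ofReal_lt_top⟩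
  refine ext_of_generate_finite
    (Set.image2 (· ×ˢ ·) (Set.range (Set.Iic : I → Set I)) (Set.range (Set.Iic : I → Set I)))
    ?_ (isPiSystem_Iic.prod isPiSystem_Iic) ?_ ?_
  · refine (generateFrom_eq_prod ?_ ?_ ?_ ?_).symm
    · exact (borel_eq_generateFrom_Iic I).symm.trans BorelSpace.measurable_eq.symm
    · exact (borel_eq_generateFrom_Iic I).symm.trans BorelSpace.measurable_eq.symm
    · exact ⟨fun _ => Set.Iic 1, fun _ => ⟨1, rfl⟩,
        Set.iUnion_eq_univ_iff.2 fun x => ⟨0, x.2.2⟩⟩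
    · exact ⟨fun _ => Set.Iic 1, fun _ => ⟨1, rfl⟩,
        Set.iUnion_eq_univ_iff.2 fun x => ⟨0, x.2.2⟩⟩
  · rintro _ ⟨_, ⟨u, rfl⟩, _, ⟨v, rfl⟩, rfl⟩
    rw [h, measure_Iic_prod]
  · rw [← Iic_one_prod, h, measure_Iic_prod]

/-- The concordance function `Q (C₁, C₂) = 4 ∫ C₂ dC₁ - 1`. -/
noncomputable def concordance (C₁ C₂ : Copula) : ℝ :=
  4 * ∫ p, C₂ p.1 p.2 ∂C₁.measure - 1

/-- Kendall's tau, `τ (C) = Q (C, C)`. -/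
noncomputable def kendallTau (C : Copula) : ℝ := concordance C C

end Copula

/-!
Let `(X, Y)` and `(X', Y')` be independent with distribution `dC`. Then `∫ C dC` is the probability
of `X' ≤ X, Y' ≤ Y`, and since the first margin is uniform, `1 / 2 - ∫ C dC` is the integral of
`x - C (x, y)`, the probability of `X' ≤ X, Y' > Y`. Each of the two is bounded from below by
looking at a single pair of opposite quadrants at a point `(p, q)` of the square:
`C (p, q) (1 - p - q + C (p, q)) ≤ ∫ C dC ≤ 1 / 2 - (p - C (p, q)) (q - C (p, q))`
(`Copula.le_integral`, `Copula.integral_le`).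

Suppose now that `C (p, q) - C (q, p) = d ≥ 0`. Both factors on the left are at least `d`, whence
`τ ≥ 4 d² - 1`. At the point `(q, p)`, monotonicity and 2-increase show that one factor on the right
is at least `d` and the other at least `2 d` (`Copula.sub_bounds_of_le_sub`), whence `τ ≤ 1 - 8 d²`;
the same two estimates give `d ≤ 1 / 3`. These are the three upper bounds for the asymmetry.

The bounds are attained by shuffles of the diagonal, that is, by the distribution of `(t, f t)` for
a piecewise isometric, measure-preserving `f` (`Copula.ofMap`). Let `g` swap two adjacent intervals.
With intervals of length `d` meeting at `1 / 3`, the map `f = 1 - g` gives `τ = 4 d² - 1`. With the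
intervals `[0, 2 d)` and `[2 d, 3 d)`, the map `f = g` gives `τ = 1 - 8 d²`. In each case one
inequality for `τ` is the general bound, and only the other has to be computed. For `d = 0` and
`d = 1 / 3` the two copulas have their asymmetry at a common point, so the asymmetry is constant on
the segment joining them, while `τ`, continuous along the segment, takes all values in between
(`Copula.exists_kendallTau_eq_of_mem_Icc`).
-/

namespace Copula

/-! ### Masses of rectangles and the bounds for `∫ C dC` -/

theorem le_left (C : Copula) (u v : I) : C u v ≤ u :=
  (C.mono_right u v.2.2).trans_eq (C.one_right u)

theorem le_right (C : Copula) (u v : I) : C u v ≤ v :=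
  C.transpose.le_left v u

theorem abs_sub_le_left (C : Copula) (u u' v : I) : |C u v - C u' v| ≤ |(u : ℝ) - u'| := by
  wlog h : u' ≤ u generalizing u u'
  · rw [abs_sub_comm, abs_sub_comm (u : ℝ)]
    exact this u' u (le_of_not_ge h)
  rw [abs_of_nonneg (sub_nonneg.2 (C.mono_left h v))]
  exact (C.sub_le_left h v).trans (le_abs_self _)

theorem continuous_uncurry (C : Copula) : Continuous fun p : I × I => C p.1 p.2 := by
  refine LipschitzWith.continuous (K := 2) (LipschitzWith.of_dist_le_mul fun p q => ?_)
  have h1 := C.abs_sub_le_left p.1 q.1 p.2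
  have h2 : |C q.1 p.2 - C q.1 q.2| ≤ |(p.2 : ℝ) - q.2| :=
    C.transpose.abs_sub_le_left p.2 q.2 q.1
  have h3 : dist p.1 q.1 ≤ dist p q := le_max_left _ _
  have h4 : dist p.2 q.2 ≤ dist p q := le_max_right _ _
  rw [Subtype.dist_eq, Real.dist_eq] at h3 h4
  have h5 := abs_sub_le (C p.1 p.2) (C q.1 p.2) (C q.1 q.2)
  rw [Real.dist_eq]
  push_cast
  linarith

theorem integrable (C : Copula) (μ : Measure (I × I)) [IsFiniteMeasure μ] :
    Integrable (fun p : I × I => C p.1 p.2) μ := by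
  refine Integrable.of_bound C.continuous_uncurry.aestronglyMeasurable 1 (ae_of_all _ fun p => ?_)
  rw [Real.norm_of_nonneg (C.nonneg _ _)]
  exact (C.le_left _ _).trans p.1.2.2

theorem measurePreserving_fst (C : Copula) :
    MeasurePreserving (Prod.fst : I × I → I) C.measure volume := by
  refine ⟨measurable_fst, ?_⟩
  have : IsFiniteMeasure (C.measure.map Prod.fst) := inferInstance
  refine Measure.ext_of_Iic _ _ fun u => ?_
  rw [Measure.map_apply measurable_fst measurableSet_Iic, unitInterval.volume_Iic,
    ← C.one_right u, ← C.measure_Iic_prod]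
  congr 1
  ext p
  have : p.2 ≤ 1 := p.2.2.2
  simp [-Set.Iic_prod_Iic, this]

theorem integral_coe_unitInterval : ∫ x : I, (x : ℝ) = 1 / 2 := by
  have h := unitInterval.measurePreserving_coe.integral_comp
    unitInterval.measurableEmbedding_coe (fun x : ℝ => x)
  rw [h, integral_Icc_eq_integral_Ioc, ← intervalIntegral.integral_of_le zero_le_one]
  simp

theorem integrable_fst (C : Copula) : Integrable (fun p : I × I => (p.1 : ℝ)) C.measure := by
  refine Integrable.of_bound (by fun_prop) 1 (ae_of_all _ fun p => ?_)
  rw [Real.norm_of_nonneg p.1.2.1]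
  exact p.1.2.2

theorem integral_fst (C : Copula) : ∫ p, (p.1 : ℝ) ∂C.measure = 1 / 2 := by
  rw [← integral_coe_unitInterval, ← C.measurePreserving_fst.map_eq,
    integral_map measurable_fst.aemeasurable (by fun_prop)]

theorem measureReal_Iic_prod_Iic (C : Copula) (p q : I) :
    C.measure.real (Set.Iic p ×ˢ Set.Iic q) = C p q := by
  rw [measureReal_def, measure_Iic_prod, ENNReal.toReal_ofReal (C.nonneg _ _)]

theorem measureReal_Ioi_prod_Iic (C : Copula) (p q : I) :
    C.measure.real (Set.Ioi p ×ˢ Set.Iic q) = q - C p q := by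
  have h : Set.Ioi p ×ˢ Set.Iic q = (Set.Iic 1 ×ˢ Set.Iic q) \ (Set.Iic p ×ˢ Set.Iic q) := by
    ext x
    have : x.1 ≤ 1 := x.1.2.2
    simp only [Set.mem_prod, Set.mem_Ioi, Set.mem_Iic, Set.mem_sdiff, this, true_and, not_and]
    constructor
    · exact fun h => ⟨h.2, fun h' => absurd h' (not_le.2 h.1)⟩
    · exact fun h => ⟨not_le.1 fun h' => h.2 h' h.1, h.1⟩
  rw [h, measureReal_sdiff (Set.prod_mono (Set.Iic_subset_Iic.2 (show p ≤ 1 from p.2.2)) le_rfl)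
    (measurableSet_Iic.prod measurableSet_Iic), measureReal_Iic_prod_Iic,
    measureReal_Iic_prod_Iic, C.one_left]

theorem measureReal_Ioi_prod_Ioi (C : Copula) (p q : I) :
    C.measure.real (Set.Ioi p ×ˢ Set.Ioi q) = 1 - p - q + C p q := by
  have h : Set.Ioi p ×ˢ Set.Ioi q = (Set.Ioi p ×ˢ Set.Iic 1) \ (Set.Ioi p ×ˢ Set.Iic q) := by
    ext x
    have : x.2 ≤ 1 := x.2.2.2
    simp only [Set.mem_prod, Set.mem_Ioi, Set.mem_Iic, Set.mem_sdiff, this, and_true, not_and,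
      not_le]
    exact ⟨fun h => ⟨h.1, fun _ => h.2⟩, fun h => ⟨h.1, h.2 h.1⟩⟩
  rw [h, measureReal_sdiff (Set.prod_mono le_rfl (Set.Iic_subset_Iic.2 (show q ≤ 1 from q.2.2)))
    (measurableSet_Ioi.prod measurableSet_Iic), measureReal_Ioi_prod_Iic,
    measureReal_Ioi_prod_Iic, C.one_right]
  simp
  ring

/-- The mass beyond `(p, q)`, where `C` is at least `C (p, q)`, bounds `∫ C dC` from below. -/
theorem le_integral (C : Copula) (p q : I) :
    C p q * (1 - p - q + C p q) ≤ ∫ x, C x.1 x.2 ∂C.measure := by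
  have hS : MeasurableSet (Set.Ioi p ×ˢ Set.Ioi q) := measurableSet_Ioi.prod measurableSet_Ioi
  have h : ∫ x, (Set.Ioi p ×ˢ Set.Ioi q).indicator (fun _ => C p q) x ∂C.measure ≤
      ∫ x, C x.1 x.2 ∂C.measure := by
    refine integral_mono ((integrable_const _).indicator hS) (C.integrable _) fun x => ?_
    refine Set.indicator_apply_le' (fun hx => ?_) fun _ => C.nonneg _ _
    exact (C.mono_left (le_of_lt hx.1) _).trans (C.mono_right _ (le_of_lt hx.2))
  rw [integral_indicator_const _ hS, measureReal_Ioi_prod_Ioi, smul_eq_mul] at h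
  linarith

/-- On `(p, 1] × [0, q]`, a rectangle of mass `q - C (p, q)`, the function `x - C (x, y)` is at
least `p - C (p, q)`, and its integral is `1 / 2 - ∫ C dC`. -/
theorem integral_le (C : Copula) (p q : I) :
    ∫ x, C x.1 x.2 ∂C.measure ≤ 1 / 2 - (p - C p q) * (q - C p q) := by
  have hS : MeasurableSet (Set.Ioi p ×ˢ Set.Iic q) := measurableSet_Ioi.prod measurableSet_Iic
  have h : ∫ x, (Set.Ioi p ×ˢ Set.Iic q).indicator (fun _ => (p : ℝ) - C p q) x ∂C.measure ≤
      ∫ x, ((x.1 : ℝ) - C x.1 x.2) ∂C.measure := by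
    refine integral_mono ((integrable_const _).indicator hS)
      (C.integrable_fst.sub (C.integrable _)) fun x => ?_
    refine Set.indicator_apply_le' (fun hx => ?_) fun _ => sub_nonneg.2 (C.le_left _ _)
    have h1 := C.sub_le_left (le_of_lt hx.1) x.2
    have h2 := C.mono_right p hx.2
    linarith
  rw [integral_indicator_const _ hS, measureReal_Ioi_prod_Iic, smul_eq_mul,
    integral_sub C.integrable_fst (C.integrable _), integral_fst] at h
  linarith

theorem neg_one_le_kendallTau (C : Copula) : -1 ≤ C.kendallTau := by
  have h : 0 ≤ ∫ x, C x.1 x.2 ∂C.measure := integral_nonneg fun x => C.nonneg _ _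
  simp only [kendallTau, concordance]
  linarith

theorem kendallTau_le_one (C : Copula) : C.kendallTau ≤ 1 := by
  have h := C.integral_le 0 0
  simp only [kendallTau, concordance]
  simp only [C.zero_left] at h
  norm_num at h
  linarith

/-! ### Bounds for the asymmetry -/

theorem four_mul_sq_sub_one_le_kendallTau (C : Copula) {p q : I} {d : ℝ} (hd : 0 ≤ d)
    (h : d ≤ C p q - C q p) : 4 * d ^ 2 - 1 ≤ C.kendallTau := by
  have h1 := C.le_integral p q
  have h2 := C.nonneg q p
  have h3 := C.two_increasing q 1 p 1 q.2.2 p.2.2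
  rw [C.one_right, C.one_left, C.one_right] at h3
  have h4 : d * d ≤ C p q * (1 - p - q + C p q) := by
    refine mul_le_mul (by linarith) ?_ hd (C.nonneg _ _)
    simp only [Set.Icc.coe_one] at h3
    linarith
  simp only [kendallTau, concordance]
  linarith

/-- Of the two numbers `p - C (q, p)` and `q - C (q, p)`, the smaller is at least `d` and the
larger at least `2 * d`, when `C (p, q) - C (q, p)` is at least `d`. -/
theorem sub_bounds_of_le_sub (C : Copula) {p q : I} {d : ℝ} (h : d ≤ C p q - C q p) :
    (d ≤ p - C q p ∧ 2 * d ≤ q - C q p) ∨ (2 * d ≤ p - C q p ∧ d ≤ q - C q p) := by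
  rcases le_total p q with hpq | hpq
  · left
    have h1 := C.le_left p q
    have h2 := C.sub_le_right q hpq
    have h3 := C.mono_left hpq q
    exact ⟨by linarith, by linarith⟩
  · right
    have h1 := C.le_right p q
    have h2 := C.sub_le_left hpq p
    have h3 := C.mono_right p hpq
    exact ⟨by linarith, by linarith⟩

theorem kendallTau_le_one_sub (C : Copula) {p q : I} {d : ℝ} (hd : 0 ≤ d)
    (h : d ≤ C p q - C q p) : C.kendallTau ≤ 1 - 8 * d ^ 2 := by
  have h1 := C.integral_le q p
  have h2 : d * (2 * d) ≤ (q - C q p) * (p - C q p) := by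
    rcases C.sub_bounds_of_le_sub h with ⟨h3, h4⟩ | ⟨h3, h4⟩
    · rw [mul_comm d]
      exact mul_le_mul h4 h3 hd (by linarith)
    · exact mul_le_mul h4 h3 (by linarith) (by linarith)
  simp only [kendallTau, concordance]
  linarith

theorem sub_swap_le_third (C : Copula) (p q : I) : C p q - C q p ≤ 1 / 3 := by
  have h3 := C.two_increasing q 1 p 1 q.2.2 p.2.2
  rw [C.one_right, C.one_left, C.one_right] at h3
  simp only [Set.Icc.coe_one] at h3
  have := C.nonneg q p
  rcases C.sub_bounds_of_le_sub (le_refl (C p q - C q p)) with ⟨h1, h2⟩ | ⟨h1, h2⟩ <;> linarith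

theorem sub_swap_le_asymmetry (C : Copula) (p q : I) : C p q - C q p ≤ C.asymmetry := by
  have hb : BddAbove (Set.range fun p : I × I => |C p.1 p.2 - C.transpose p.1 p.2|) := by
    refine ⟨1 / 3, ?_⟩
    rintro _ ⟨x, rfl⟩
    have h : C.transpose x.1 x.2 = C x.2 x.1 := rfl
    exact abs_le.2 ⟨by linarith [C.sub_swap_le_third x.2 x.1], C.sub_swap_le_third _ _⟩
  exact (le_abs_self _).trans (le_ciSup hb (p, q))

theorem asymmetry_le (C : Copula) {d : ℝ} (h : ∀ p q, C p q - C q p ≤ d) : C.asymmetry ≤ d := by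
  refine ciSup_le fun x => abs_le.2 ⟨?_, h _ _⟩
  have := h x.2 x.1
  simp only [transpose]
  linarith

theorem asymmetry_nonneg (C : Copula) : 0 ≤ C.asymmetry := by
  simpa using C.sub_swap_le_asymmetry 0 0

theorem asymmetry_le_third (C : Copula) : C.asymmetry ≤ 1 / 3 :=
  C.asymmetry_le C.sub_swap_le_third

theorem asymmetry_le_sqrt_one_add (C : Copula) : C.asymmetry ≤ √((1 + C.kendallTau) / 4) := by
  refine C.asymmetry_le fun p q => ?_
  rcases le_total (C p q - C q p) 0 with h | h
  · exact h.trans (Real.sqrt_nonneg _)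
  · apply Real.le_sqrt_of_sq_le
    linarith [C.four_mul_sq_sub_one_le_kendallTau h le_rfl]

theorem asymmetry_le_sqrt_one_sub (C : Copula) : C.asymmetry ≤ √((1 - C.kendallTau) / 8) := by
  refine C.asymmetry_le fun p q => ?_
  rcases le_total (C p q - C q p) 0 with h | h
  · exact h.trans (Real.sqrt_nonneg _)
  · apply Real.le_sqrt_of_sq_le
    linarith [C.kendallTau_le_one_sub h le_rfl]

/-! ### Copulas of measure-preserving maps -/

/-- The copula of a measure-preserving self-map `f` of the unit interval: the joint distribution
function of `t` and `f t`, where `t` is uniformly distributed. -/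
noncomputable def ofMap (f : I → I) (hf : MeasurePreserving f) : Copula where
  toFun u v := volume.real (Set.Iic u ∩ f ⁻¹' Set.Iic v)
  zero_left v := by
    refine measureReal_mono_null Set.inter_subset_left ?_
    simp [measureReal_def]
  zero_right u := by
    refine measureReal_mono_null Set.inter_subset_right ?_
    rw [hf.measureReal_preimage measurableSet_Iic.nullMeasurableSet]
    simp [measureReal_def]
  one_left v := by
    have h : Set.Iic (1 : I) = Set.univ := Set.eq_univ_of_forall fun x => x.2.2
    rw [h, Set.univ_inter, hf.measureReal_preimage measurableSet_Iic.nullMeasurableSet]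
    simp [measureReal_def, v.2.1]
  one_right u := by
    have h : Set.Iic (1 : I) = Set.univ := Set.eq_univ_of_forall fun x => x.2.2
    rw [h, Set.preimage_univ, Set.inter_univ]
    simp [measureReal_def, u.2.1]
  two_increasing u₁ u₂ v₁ v₂ hu hv := by
    have h : ∀ v, volume.real (Set.Iic u₂ ∩ f ⁻¹' Set.Iic v) =
        volume.real (Set.Iic u₁ ∩ f ⁻¹' Set.Iic v) +
          volume.real (Set.Ioc u₁ u₂ ∩ f ⁻¹' Set.Iic v) := by
      intro v
      rw [← Set.Iic_union_Ioc_eq_Iic hu, Set.union_inter_distrib_right]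
      exact measureReal_union (((Set.Iic_disjoint_Ioc le_rfl).mono Set.inter_subset_left
        Set.inter_subset_left)) (measurableSet_Ioc.inter (hf.measurable measurableSet_Iic))
    have h' : volume.real (Set.Ioc u₁ u₂ ∩ f ⁻¹' Set.Iic v₁) ≤
        volume.real (Set.Ioc u₁ u₂ ∩ f ⁻¹' Set.Iic v₂) :=
      measureReal_mono (Set.inter_subset_inter_right _
        (Set.preimage_mono (Set.Iic_subset_Iic.2 hv)))
    linarith [h v₁, h v₂]

theorem ofMap_apply (f : I → I) (hf : MeasurePreserving f) (u v : I) :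
    ofMap f hf u v = volume.real (Set.Iic u ∩ f ⁻¹' Set.Iic v) := rfl

theorem measurable_graph {f : I → I} (hf : MeasurePreserving f) :
    Measurable fun t => (t, f t) :=
  measurable_id.prodMk hf.measurable

theorem measure_ofMap (f : I → I) (hf : MeasurePreserving f) :
    (ofMap f hf).measure = (volume : Measure I).map fun t => (t, f t) := by
  refine (eq_measure _ _ fun u v => ?_).symm
  rw [Measure.map_apply (measurable_graph hf)
    (measurableSet_Iic.prod measurableSet_Iic), ofMap_apply, ofReal_measureReal]
  rfl

theorem kendallTau_ofMap (f : I → I) (hf : MeasurePreserving f) :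
    (ofMap f hf).kendallTau = 4 * (∫ t, ofMap f hf t (f t)) - 1 := by
  rw [kendallTau, concordance, measure_ofMap, integral_map
    (measurable_graph hf).aemeasurable (continuous_uncurry _).aestronglyMeasurable]

theorem integrable_ofMap (f : I → I) (hf : MeasurePreserving f) :
    Integrable fun t => ofMap f hf t (f t) := by
  have h := (ofMap f hf).integrable ((volume : Measure I).map fun t => (t, f t))
  exact h.comp_measurable (measurable_graph hf)

/-! ### Exchanging two adjacent intervals -/

/-- The interval exchange of the line that swaps `[p, q)` and `[q, r)` by translations. -/
noncomputable def exchange (p q r x : ℝ) : ℝ :=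
  if x ∈ Set.Ico p q then x + (r - q) else if x ∈ Set.Ico q r then x - (q - p) else x

theorem measurable_exchange (p q r : ℝ) : Measurable (exchange p q r) :=
  Measurable.ite measurableSet_Ico (by fun_prop)
    (Measurable.ite measurableSet_Ico (by fun_prop) measurable_id)

theorem measurePreserving_exchange {p q r : ℝ} (hpq : p ≤ q) (hqr : q ≤ r) :
    MeasurePreserving (exchange p q r) := by
  refine ⟨measurable_exchange p q r, Measure.ext fun s hs => ?_⟩
  rw [Measure.map_apply (measurable_exchange p q r) hs]
  have h1 := measure_inter_add_sdiff (μ := volume) (exchange p q r ⁻¹' s)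
    (measurableSet_Ico (a := p) (b := r))
  have h2 := measure_inter_add_sdiff (μ := volume) (exchange p q r ⁻¹' s ∩ Set.Ico p r)
    (measurableSet_Ico (a := p) (b := q))
  have h3 := measure_inter_add_sdiff (μ := volume) s (measurableSet_Ico (a := p) (b := r))
  have h4 := measure_inter_add_sdiff (μ := volume) (s ∩ Set.Ico p r)
    (measurableSet_Ico (a := p) (b := p + (r - q)))
  have e1 : exchange p q r ⁻¹' s \ Set.Ico p r = s \ Set.Ico p r := by
    ext x
    simp only [exchange, Set.mem_sdiff, Set.mem_preimage, Set.mem_Ico]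
    grind
  have e2 : exchange p q r ⁻¹' s ∩ Set.Ico p r ∩ Set.Ico p q =
      (fun x => x + (r - q)) ⁻¹' ((s ∩ Set.Ico p r) \ Set.Ico p (p + (r - q))) := by
    ext x
    simp only [exchange, Set.mem_sdiff, Set.mem_preimage, Set.mem_Ico, Set.mem_inter_iff]
    grind
  have e3 : (exchange p q r ⁻¹' s ∩ Set.Ico p r) \ Set.Ico p q =
      (fun x => x + (p - q)) ⁻¹' (s ∩ Set.Ico p r ∩ Set.Ico p (p + (r - q))) := by
    ext x
    have e : x - (q - p) = x + (p - q) := by ring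
    simp only [exchange, Set.mem_sdiff, Set.mem_preimage, Set.mem_Ico, Set.mem_inter_iff, e]
    grind
  rw [e2, e3, measure_preimage_add_right, measure_preimage_add_right, add_comm] at h2
  rw [← h1, ← h3, ← h2, ← h4, e1]

/-- An interval exchange reverses the order of two points only if one lies in each of the two
intervals. -/
theorem exchange_lt_exchange {p q r s t : ℝ} (hpq : p ≤ q) (hqr : q ≤ r) (hst : s < t)
    (h : s ∈ Set.Ico p q → t ∉ Set.Ico q r) : exchange p q r s < exchange p q r t := by
  simp only [Set.mem_Ico] at h
  simp only [exchange, Set.mem_Ico]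
  split_ifs <;> grind

theorem exchange_mem_unitInterval_iff {p q r : ℝ} (hp : 0 ≤ p) (hpq : p ≤ q) (hqr : q ≤ r)
    (hr : r ≤ 1) (x : ℝ) : exchange p q r x ∈ I ↔ x ∈ I := by
  simp only [exchange, Set.mem_Icc, Set.mem_Ico]
  grind

/-- The interval exchange `exchange p q r` as a self-map of the unit interval. It is cut off by
`Set.projIcc`, which has no effect when `0 ≤ p ≤ q ≤ r ≤ 1`. -/
noncomputable def exchangeI (p q r : ℝ) (t : I) : I :=
  Set.projIcc 0 1 zero_le_one (exchange p q r t)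

theorem coe_exchangeI {p q r : ℝ} (hp : 0 ≤ p) (hpq : p ≤ q) (hqr : q ≤ r)
    (hr : r ≤ 1) (t : I) : (exchangeI p q r t : ℝ) = exchange p q r t := by
  rw [exchangeI, Set.projIcc_of_mem _ ((exchange_mem_unitInterval_iff hp hpq hqr hr t).2 t.2)]

theorem measurePreserving_exchangeI {p q r : ℝ} (hp : 0 ≤ p) (hpq : p ≤ q) (hqr : q ≤ r)
    (hr : r ≤ 1) : MeasurePreserving (exchangeI p q r) := by
  have hm : Measurable (exchangeI p q r) :=
    continuous_projIcc.measurable.comp ((measurable_exchange p q r).comp measurable_subtype_coe)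
  refine ⟨hm, Measure.ext fun s hs => ?_⟩
  rw [Measure.map_apply hm hs, unitInterval.volume_apply, unitInterval.volume_apply (s := s),
    ← (measurePreserving_exchange hpq hqr).measure_preimage
      (measurableSet_Icc.subtype_image hs).nullMeasurableSet]
  congr 1
  ext x
  constructor
  · rintro ⟨t, ht, rfl⟩
    exact ⟨_, ht, coe_exchangeI hp hpq hqr hr t⟩
  · rintro ⟨y, hy, hyx⟩
    have hx : x ∈ I := (exchange_mem_unitInterval_iff hp hpq hqr hr x).1 (hyx ▸ y.2)
    refine ⟨⟨x, hx⟩, ?_, rfl⟩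
    have : exchangeI p q r ⟨x, hx⟩ = y :=
      Subtype.ext ((coe_exchangeI hp hpq hqr hr _).trans hyx.symm)
    rwa [Set.mem_preimage, this]

/-! ### Copulas of extremal Kendall's tau -/

theorem volumeReal_coe_preimage_Ico {a b : ℝ} (ha : 0 ≤ a) (hab : a ≤ b) (hb : b ≤ 1) :
    volume.real ((↑) ⁻¹' Set.Ico a b : Set I) = b - a := by
  have hI : Set.Ico a b ⊆ I := fun x hx => ⟨ha.trans hx.1, hx.2.le.trans hb⟩
  rw [unitInterval.measurePreserving_coe.measureReal_preimage
    measurableSet_Ico.nullMeasurableSet, measureReal_restrict_apply measurableSet_Ico,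
    Set.inter_eq_left.2 hI,
    Real.volume_real_Ico_of_le hab]

/-- The least value of Kendall's tau for given asymmetry `d`: the map that exchanges two adjacent
intervals of length `d` and then reverses the order has as its only concordant pairs those formed
by one point of each interval. -/
theorem exists_kendallTau_eq_four_mul_sq_sub_one {d : ℝ} (h0 : 0 ≤ d) (h1 : d ≤ 1 / 3) (p q : I)
    (hp : (p : ℝ) = 1 / 3) (hq : (q : ℝ) = 2 / 3) :
    ∃ C : Copula, C.kendallTau = 4 * d ^ 2 - 1 ∧ C.asymmetry = d ∧ C p q - C q p = d := by
  have ha : 0 ≤ 1 / 3 - d := by linarith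
  have hb : 1 / 3 - d ≤ 1 / 3 := by linarith
  have hc : 1 / 3 ≤ 1 / 3 + d := by linarith
  have hd : 1 / 3 + d ≤ 1 := by linarith
  have hg := measurePreserving_exchangeI ha hb hc hd
  have hf := unitInterval.measurePreserving_symm.comp hg
  let f : I → I := σ ∘ exchangeI (1 / 3 - d) (1 / 3) (1 / 3 + d)
  have hval : ∀ t : I, (f t : ℝ) = 1 - exchange (1 / 3 - d) (1 / 3) (1 / 3 + d) t := fun t => by
    rw [← coe_exchangeI ha hb hc hd]
    rfl
  have hlt : ∀ s t : I, s < t → ((s : ℝ) ∈ Set.Ico (1 / 3 - d) (1 / 3) →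
      (t : ℝ) ∉ Set.Ico (1 / 3) (1 / 3 + d)) → f t < f s := fun s t hst h => by
    rw [← Subtype.coe_lt_coe, hval, hval]
    exact sub_lt_sub_left (exchange_lt_exchange hb hc hst h) 1
  let C : Copula := ofMap f hf
  have hpq : d ≤ C p q := by
    have h : volume.real ((↑) ⁻¹' Set.Ico (1 / 3 - d) (1 / 3) : Set I) ≤ C p q := by
      refine measureReal_mono fun t ht => ⟨?_, ?_⟩
      · rw [Set.mem_Iic, ← Subtype.coe_le_coe, hp]
        exact ht.2.le
      · rw [Set.mem_preimage, Set.mem_Iic, ← Subtype.coe_le_coe, hq, hval, exchange,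
          if_pos (Set.mem_preimage.1 ht)]
        linarith [(Set.mem_preimage.1 ht).1]
    rw [volumeReal_coe_preimage_Ico ha hb (by norm_num)] at h
    linarith
  have hqp : C q p = 0 := by
    refine measureReal_mono_null (s₂ := {q}) ?_ (by simp [measureReal_def])
    have hout : (q : ℝ) ∉ Set.Ico (1 / 3) (1 / 3 + d) := fun h => by linarith [h.2]
    have hfq : f q = p := by
      rw [Subtype.ext_iff, hval, exchange, if_neg fun h => by linarith [h.2], if_neg hout, hp, hq]
      norm_num
    rintro t ⟨ht, ht'⟩
    by_contra hmem
    exact (hlt t q (lt_of_le_of_ne ht hmem) fun _ => hout).not_ge (ht'.trans_eq hfq.symm)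
  have hdiff : d ≤ C p q - C q p := by rw [hqp, sub_zero]; exact hpq
  have hle : ∫ t, C t (f t) ≤ d ^ 2 := by
    have hS : MeasurableSet ((↑) ⁻¹' Set.Ico (1 / 3) (1 / 3 + d) : Set I) :=
      measurable_subtype_coe measurableSet_Ico
    calc ∫ t, C t (f t)
        ≤ ∫ t : I, ((↑) ⁻¹' Set.Ico (1 / 3) (1 / 3 + d) : Set I).indicator (fun _ => d) t := by
          refine integral_mono (integrable_ofMap f hf) ((integrable_const _).indicator hS)
            fun t => ?_
          refine Set.le_indicator_apply (fun ht => ?_) fun ht => le_of_eq ?_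
          · calc C t (f t)
                ≤ volume.real (((↑) ⁻¹' Set.Ico (1 / 3 - d) (1 / 3) : Set I) ∪ {t}) := by
                  refine measureReal_mono ?_
                  rintro s ⟨hs, hs'⟩
                  by_contra hmem
                  rw [Set.mem_union, Set.mem_singleton_iff, not_or] at hmem
                  exact (hlt s t (lt_of_le_of_ne hs hmem.2) fun h => absurd h hmem.1).not_ge hs'
              _ ≤ _ := measureReal_union_le _ _
              _ = d := by
                  rw [volumeReal_coe_preimage_Ico ha hb (by norm_num)]
                  simp [measureReal_def]
          · refine measureReal_mono_null (s₂ := {t}) ?_ (by simp [measureReal_def])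
            rintro s ⟨hs, hs'⟩
            by_contra hmem
            exact (hlt s t (lt_of_le_of_ne hs hmem) fun _ => ht).not_ge hs'
      _ = d ^ 2 := by
          rw [integral_indicator_const _ hS,
            volumeReal_coe_preimage_Ico (by norm_num) hc hd, smul_eq_mul]
          ring
  have hτ : C.kendallTau = 4 * d ^ 2 - 1 := by
    refine le_antisymm ?_ (C.four_mul_sq_sub_one_le_kendallTau h0 hdiff)
    rw [kendallTau_ofMap]
    change 4 * (∫ t, C t (f t)) - 1 ≤ _
    linarith
  have hasym : C.asymmetry = d := by
    refine le_antisymm ?_ (hdiff.trans (C.sub_swap_le_asymmetry p q))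
    have h := C.asymmetry_le_sqrt_one_add
    rwa [hτ, show (1 + (4 * d ^ 2 - 1)) / 4 = d ^ 2 by ring, Real.sqrt_sq h0] at h
  exact ⟨C, hτ, hasym, le_antisymm (hasym ▸ C.sub_swap_le_asymmetry p q) hdiff⟩

/-- The greatest value of Kendall's tau for given asymmetry `d`: the map that exchanges the
intervals `[0, 2 * d)` and `[2 * d, 3 * d)` has as its only discordant pairs those formed by one
point of each interval. -/
theorem exists_kendallTau_eq_one_sub {d : ℝ} (h0 : 0 ≤ d) (h1 : d ≤ 1 / 3) (p q : I)
    (hp : (p : ℝ) = d) (hq : (q : ℝ) = 2 * d) :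
    ∃ C : Copula, C.kendallTau = 1 - 8 * d ^ 2 ∧ C.asymmetry = d ∧ C p q - C q p = d := by
  have hb : 0 ≤ 2 * d := by linarith
  have hc : 2 * d ≤ 3 * d := by linarith
  have hd : 3 * d ≤ 1 := by linarith
  have hf := measurePreserving_exchangeI le_rfl hb hc hd
  let f : I → I := exchangeI 0 (2 * d) (3 * d)
  have hval : ∀ t : I, (f t : ℝ) = exchange 0 (2 * d) (3 * d) t :=
    coe_exchangeI le_rfl hb hc hd
  have hlt : ∀ s t : I, s < t → ((s : ℝ) ∈ Set.Ico 0 (2 * d) →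
      (t : ℝ) ∉ Set.Ico (2 * d) (3 * d)) → f s < f t := fun s t hst h => by
    rw [← Subtype.coe_lt_coe, hval, hval]
    exact exchange_lt_exchange hb hc hst h
  let C : Copula := ofMap f hf
  have hpq : d ≤ C p q := by
    have h : volume.real ((↑) ⁻¹' Set.Ico 0 d : Set I) ≤ C p q := by
      refine measureReal_mono fun t ht => ⟨?_, ?_⟩
      · rw [Set.mem_Iic, ← Subtype.coe_le_coe, hp]
        exact ht.2.le
      · rw [Set.mem_preimage, Set.mem_Iic, ← Subtype.coe_le_coe, hq, hval, exchange,
          if_pos ⟨ht.1, by linarith [ht.2]⟩]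
        linarith [ht.2]
    rw [volumeReal_coe_preimage_Ico le_rfl h0 (by linarith)] at h
    linarith
  have hqp : C q p = 0 := by
    refine measureReal_mono_null (s₂ := {0} ∪ {q}) ?_ ?_
    · rintro t ⟨ht, ht'⟩
      have h0t := t.2.1
      rw [Set.mem_Iic, ← Subtype.coe_le_coe, hq] at ht
      rw [Set.mem_preimage, Set.mem_Iic, ← Subtype.coe_le_coe, hp, hval, exchange] at ht'
      simp only [Set.mem_Ico] at ht'
      simp only [Set.mem_union, Set.mem_singleton_iff, Subtype.ext_iff, hq, Set.Icc.coe_zero]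
      grind
    · exact measureReal_union_null (by simp [measureReal_def]) (by simp [measureReal_def])
  have hdiff : d ≤ C p q - C q p := by rw [hqp, sub_zero]; exact hpq
  have hle : 1 / 2 - 2 * d ^ 2 ≤ ∫ t, C t (f t) := by
    have hS : MeasurableSet ((↑) ⁻¹' Set.Ico (2 * d) (3 * d) : Set I) :=
      measurable_subtype_coe measurableSet_Ico
    have hid : Integrable fun t : I => (t : ℝ) :=
      Integrable.of_bound (by fun_prop) 1 (ae_of_all _ fun t => by
        rw [Real.norm_of_nonneg t.2.1]
        exact t.2.2)
    have hind : Integrable (((↑) ⁻¹' Set.Ico (2 * d) (3 * d) : Set I).indicator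
        fun _ => 2 * d) := (integrable_const _).indicator hS
    have hmass : ∀ (a : ℝ) (t : I), 0 ≤ a → a ≤ t →
        (∀ s : I, a ≤ s → s < t → f s ≤ f t) → (t : ℝ) - a ≤ C t (f t) := by
      intro a t ha hat h
      rw [← volumeReal_coe_preimage_Ico ha hat t.2.2]
      exact measureReal_mono fun s hs => ⟨le_of_lt hs.2, h s hs.1 hs.2⟩
    calc 1 / 2 - 2 * d ^ 2
        = ∫ t : I, ((t : ℝ) -
            ((↑) ⁻¹' Set.Ico (2 * d) (3 * d) : Set I).indicator (fun _ => 2 * d) t) := by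
          rw [integral_sub hid hind, integral_indicator_const _ hS,
            volumeReal_coe_preimage_Ico hb hc hd, integral_coe_unitInterval, smul_eq_mul]
          ring
      _ ≤ ∫ t, C t (f t) := by
          refine integral_mono (hid.sub hind) (integrable_ofMap f hf) fun t => ?_
          by_cases ht : (t : ℝ) ∈ Set.Ico (2 * d) (3 * d)
          · simp only [Set.indicator_of_mem (Set.mem_preimage.2 ht)]
            refine hmass _ _ hb ht.1 fun s hs hst => ?_
            exact (hlt s t hst fun h => absurd h.2 hs.not_gt).le
          · simp only [Set.indicator_of_notMem (mt Set.mem_preimage.1 ht)]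
            refine hmass _ _ le_rfl t.2.1 fun s hs hst => ?_
            exact (hlt s t hst fun _ => ht).le
  have hτ : C.kendallTau = 1 - 8 * d ^ 2 := by
    refine le_antisymm (C.kendallTau_le_one_sub h0 hdiff) ?_
    rw [kendallTau_ofMap]
    change _ ≤ 4 * (∫ t, C t (f t)) - 1
    linarith
  have hasym : C.asymmetry = d := by
    refine le_antisymm ?_ (hdiff.trans (C.sub_swap_le_asymmetry p q))
    have h := C.asymmetry_le_sqrt_one_sub
    rwa [hτ, show (1 - (1 - 8 * d ^ 2)) / 8 = d ^ 2 by ring, Real.sqrt_sq h0] at h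
  exact ⟨C, hτ, hasym, le_antisymm (hasym ▸ C.sub_swap_le_asymmetry p q) hdiff⟩

/-! ### Convex combinations -/

/-- The convex combination `(1 - t) C + t D` of two copulas. -/
def mix (C D : Copula) (t : I) : Copula where
  toFun u v := (1 - t) * C u v + t * D u v
  zero_left v := by simp [C.zero_left, D.zero_left]
  zero_right u := by simp [C.zero_right, D.zero_right]
  one_left v := by rw [C.one_left, D.one_left]; ring
  one_right u := by rw [C.one_right, D.one_right]; ring
  two_increasing u₁ u₂ v₁ v₂ hu hv := by
    have h1 := mul_nonneg (sub_nonneg.2 t.2.2) (C.two_increasing u₁ u₂ v₁ v₂ hu hv)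
    have h2 := mul_nonneg t.2.1 (D.two_increasing u₁ u₂ v₁ v₂ hu hv)
    linarith

theorem mix_apply (C D : Copula) (t u v : I) :
    C.mix D t u v = (1 - t) * C u v + t * D u v := rfl

theorem measure_mix (C D : Copula) (t : I) :
    (C.mix D t).measure =
      ENNReal.ofReal (1 - t) • C.measure + ENNReal.ofReal t • D.measure := by
  refine (eq_measure _ _ fun u v => ?_).symm
  rw [Measure.add_apply, Measure.smul_apply, Measure.smul_apply, measure_Iic_prod,
    measure_Iic_prod, smul_eq_mul, smul_eq_mul, ← ENNReal.ofReal_mul (sub_nonneg.2 t.2.2),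
    ← ENNReal.ofReal_mul t.2.1, ← ENNReal.ofReal_add, mix_apply]
  · exact mul_nonneg (sub_nonneg.2 t.2.2) (C.nonneg _ _)
  · exact mul_nonneg t.2.1 (D.nonneg _ _)

theorem concordance_mix_left (C D E : Copula) (t : I) :
    concordance (C.mix D t) E = (1 - t) * concordance C E + t * concordance D E := by
  have h : 0 ≤ 1 - (t : ℝ) := sub_nonneg.2 t.2.2
  rw [concordance, measure_mix, integral_add_measure
    ((E.integrable _).smul_measure ENNReal.ofReal_ne_top)
    ((E.integrable _).smul_measure ENNReal.ofReal_ne_top), integral_smul_measure,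
    integral_smul_measure, ENNReal.toReal_ofReal h, ENNReal.toReal_ofReal t.2.1, smul_eq_mul,
    smul_eq_mul, concordance, concordance]
  ring

theorem concordance_mix_right (C D E : Copula) (t : I) :
    concordance E (C.mix D t) = (1 - t) * concordance E C + t * concordance E D := by
  simp only [concordance, mix_apply]
  rw [integral_add ((C.integrable _).const_mul _) ((D.integrable _).const_mul _),
    integral_const_mul, integral_const_mul]
  ring

theorem continuous_kendallTau_mix (C D : Copula) :
    Continuous fun t => (C.mix D t).kendallTau := by
  simp only [kendallTau, concordance_mix_left, concordance_mix_right]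
  fun_prop

/-- Along the segment from `C` to `D` the asymmetry stays `d` while Kendall's tau takes all
intermediate values, provided that the asymmetries of `C` and `D` are both `d` and attained at the
same point with the same sign. -/
theorem exists_kendallTau_eq_of_mem_Icc {C D : Copula} {d τ : ℝ} {p q : I}
    (hC : C.asymmetry = d) (hD : D.asymmetry = d) (hC' : C p q - C q p = d)
    (hD' : D p q - D q p = d) (h : τ ∈ Set.Icc C.kendallTau D.kendallTau) :
    ∃ E : Copula, E.kendallTau = τ ∧ E.asymmetry = d := by
  have h0 : (C.mix D 0).kendallTau = C.kendallTau := by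
    simp [kendallTau, concordance_mix_left, concordance_mix_right]
  have h1 : (C.mix D 1).kendallTau = D.kendallTau := by
    simp [kendallTau, concordance_mix_left, concordance_mix_right]
  obtain ⟨t, ht⟩ := mem_range_of_exists_le_of_exists_ge (continuous_kendallTau_mix C D)
    ⟨0, h0.trans_le h.1⟩ ⟨1, h.2.trans_eq h1.symm⟩
  refine ⟨C.mix D t, ht, le_antisymm (asymmetry_le _ fun u v => ?_) ?_⟩
  · have h2 := mul_le_mul_of_nonneg_left (C.sub_swap_le_asymmetry u v) (sub_nonneg.2 t.2.2)
    have h3 := mul_le_mul_of_nonneg_left (D.sub_swap_le_asymmetry u v) t.2.1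
    rw [hC] at h2
    rw [hD] at h3
    simp only [mix_apply]
    linarith
  · refine le_trans (le_of_eq ?_) ((C.mix D t).sub_swap_le_asymmetry p q)
    simp only [mix_apply]
    linear_combination (-(1 - (t : ℝ))) * hC' - t * hD'

end Copula

/-! ### The sharp bounds -/

theorem corollary6p3 :
    (∀ (C : Copula) (τ : ℝ), C.kendallTau = τ →
      (-1 ≤ τ ∧ τ ≤ 1) ∧
      0 ≤ C.asymmetry ∧
      (τ ≤ -5 / 9 → C.asymmetry ≤ √((1 + τ) / 4)) ∧
      (-5 / 9 ≤ τ → τ ≤ 1 / 9 → C.asymmetry ≤ 1 / 3) ∧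
      (1 / 9 ≤ τ → C.asymmetry ≤ √((1 - τ) / 8))) ∧
    (∀ τ : ℝ, -1 ≤ τ → τ ≤ 1 →
      (∃ C : Copula, C.kendallTau = τ ∧ C.asymmetry = 0) ∧
      (τ ≤ -5 / 9 → ∃ C : Copula, C.kendallTau = τ ∧ C.asymmetry = √((1 + τ) / 4)) ∧
      (-5 / 9 ≤ τ → τ ≤ 1 / 9 → ∃ C : Copula, C.kendallTau = τ ∧ C.asymmetry = 1 / 3) ∧
      (1 / 9 ≤ τ → ∃ C : Copula, C.kendallTau = τ ∧ C.asymmetry = √((1 - τ) / 8))) := by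
  refine ⟨?_, fun τ hτ hτ' => ?_⟩
  · rintro C τ rfl
    exact ⟨⟨C.neg_one_le_kendallTau, C.kendallTau_le_one⟩, C.asymmetry_nonneg,
      fun _ => C.asymmetry_le_sqrt_one_add, fun _ _ => C.asymmetry_le_third,
      fun _ => C.asymmetry_le_sqrt_one_sub⟩
  let p : I := ⟨1 / 3, by norm_num, by norm_num⟩
  let q : I := ⟨2 / 3, by norm_num, by norm_num⟩
  refine ⟨?_, fun h => ?_, fun h h' => ?_, fun h => ?_⟩
  · obtain ⟨C, hC, hC', -⟩ :=
      Copula.exists_kendallTau_eq_four_mul_sq_sub_one le_rfl (by norm_num) p q rfl rfl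
    obtain ⟨D, hD, hD', -⟩ :=
      Copula.exists_kendallTau_eq_one_sub le_rfl (by norm_num) 0 0 (by simp) (by simp)
    exact Copula.exists_kendallTau_eq_of_mem_Icc hC' hD' (sub_self (C 0 0)) (sub_self (D 0 0))
      ⟨by rw [hC]; linarith, by rw [hD]; linarith⟩
  · obtain ⟨C, hC, hC', -⟩ :=
      Copula.exists_kendallTau_eq_four_mul_sq_sub_one (Real.sqrt_nonneg ((1 + τ) / 4))
        (Real.sqrt_le_iff.2 ⟨by norm_num, by linarith⟩) p q rfl rfl
    refine ⟨C, ?_, hC'⟩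
    rw [hC, Real.sq_sqrt (by linarith)]
    ring
  · obtain ⟨C, hC, hC', hC''⟩ :=
      Copula.exists_kendallTau_eq_four_mul_sq_sub_one (d := 1 / 3) (by norm_num) le_rfl p q
        rfl rfl
    obtain ⟨D, hD, hD', hD''⟩ :=
      Copula.exists_kendallTau_eq_one_sub (d := 1 / 3) (by norm_num) le_rfl p q rfl
        (by norm_num [q])
    exact Copula.exists_kendallTau_eq_of_mem_Icc hC' hD' hC'' hD''
      ⟨by rw [hC]; linarith, by rw [hD]; linarith⟩
  · have h0 := Real.sqrt_nonneg ((1 - τ) / 8)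
    have h1 : √((1 - τ) / 8) ≤ 1 / 3 := Real.sqrt_le_iff.2 ⟨by norm_num, by linarith⟩
    obtain ⟨C, hC, hC', -⟩ := Copula.exists_kendallTau_eq_one_sub h0 h1
      ⟨√((1 - τ) / 8), h0, by linarith⟩ ⟨2 * √((1 - τ) / 8), by linarith, by linarith⟩ rfl rfl
    refine ⟨C, ?_, hC'⟩
    rw [hC, Real.sq_sqrt (by linarith)]
    ring
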